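/- Let $A$ be a separable, unital $C^*$-algebra and let $\alpha\in\mathrm{Aut}(A)$. We say that $\alpha$ has the tracial quasi-Rokhlin property if for every $\varepsilon>0$, every finite set $F\subset A$, every $n\in\mathbb{N}$, and every positive element $x\in A$ with $\|x\|=1$, there exist $c_0,\dots,c_n\in A$ such that: (1) $0\le c_j\le 1$ for $0\le j\le n$; (2) $c_jc_k=0$ for $0\le j,k\le n$ and $j\ne k$; (3) $\|\alpha(c_j)-c_{j+1}\|<\varepsilon$ for $0\le j\le n-1$; (4) $\|c_ja-ac_j\|<\varepsilon$ for $0\le j\le n$ and all $a\in F$; (5) with $c=\sum_{j=0}^n c_j$, there exist $N\in\mathbb{N}$, positive elements $e_0,\dots,e_N\in A$, unitaries $w_0,\dots,w_N\in A$, and $d(0),\dots,d(N)\in\mathbb{Z}$ such that $1-c\le\sum_{j=0}^N e_j$; $w_j\alpha^{d(j)}(e_j)w_j^*\,w_k\alpha^{d(k)}(e_k)w_k^*=0$ for $0\le j,k\le N$ and $j\ne k$; and $w_j\alpha^{d(j)}(e_j)w_j^*\in\overline{xAx}$ for $0\le j\le N$; (6) with $c$ as above, $\|cxc\|>1-\varepsilon$.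 We say that $A$ is $\alpha$-simple if $A\neq 0$ and the only closed two-sided ideals $I$ of $A$ with $\alpha(I)=I$ are $0$ and $A$. A $C^*$-algebra is simple if it is non-zero and its only closed two-sided ideals are $0$ and the algebra itself. The crossed product $C^*(\mathbb{Z},A,\alpha)$ is the $C^*$-algebra generated by the universal covariant representation of $(\mathbb{Z},A,\alpha)$, that is, the completion of the $*$-algebra of finite sums $\sum_k a_ku^k$ (with $a_k\in A$, $u$ unitary, and $uau^*=\alpha(a)$ for $a\in A$) in the norm $\left\|\sum_k a_ku^k\right\|=\sup_{(\pi,U)}\left\|\sum_k\pi(a_k)U^k\right\|$, where the supremum is over all pairs of a unital representation $\pi$ of $A$ on a Hilbert space and a unitary $U$ on that space with $U\pi(a)U^*=\pi(\alpha(a))$ for all $a\in A$. Theorem. Let $A$ be a separable, unital $C^*$-algebra, let $\alpha\in\mathrm{Aut}(A)$ have the tracial quasi-Rokhlin property, and suppose that $A$ is $\alpha$-simple. Then the crossed product $C^*(\mathbb{Z},A,\alpha)$ is simple. -/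

import Mathlib

open scoped ENNReal

universe u

noncomputable section

/-- The C⋆-algebra of bounded families `(bᵢ)` in a family of non-zero unital C⋆-algebras, with
coordinatewise operations and the supremum norm. -/
instance lpInftyCStarAlgebra {I : Type*} {B : I → Type*} [∀ i, Nontrivial (B i)]
    [∀ i, CStarAlgebra (B i)] : CStarAlgebra (lp B ∞) where

section Dynamics

variable {A : Type u} [CStarAlgebra A]

/-- A covariant representation of `(ℤ, A, α)` on a non-zero Hilbert space `H`: a unital
⋆-representation `π` of `A` on `H` and a unitary `U` on `H` with `π (α a) = U π(a) U⋆`.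
(A unitary representation of `ℤ` is the same thing as the single unitary `U`.) -/
structure CovariantRep (α : A ≃⋆ₐ[ℂ] A) : Type (u + 1) where
  /-- the Hilbert space -/
  H : Type u
  [normedAddCommGroup : NormedAddCommGroup H]
  [innerProductSpace : InnerProductSpace ℂ H]
  [completeSpace : CompleteSpace H]
  [nontrivial : Nontrivial H]
  /-- the representation of the algebra -/
  π : A →⋆ₐ[ℂ] (H →L[ℂ] H)
  /-- the unitary implementing the automorphism -/
  U : unitary (H →L[ℂ] H)
  covariant : ∀ a : A, π (α a) = (U : H →L[ℂ] H) * π a * star (U : H →L[ℂ] H)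

attribute [instance] CovariantRep.normedAddCommGroup CovariantRep.innerProductSpace
  CovariantRep.completeSpace CovariantRep.nontrivial

/-- The bounded operators on the Hilbert space of a covariant representation. -/
abbrev CovariantRep.Op {α : A ≃⋆ₐ[ℂ] A} (ρ : CovariantRep α) : Type u := ρ.H →L[ℂ] ρ.H

instance CovariantRep.instCStarAlgebraOp {α : A ≃⋆ₐ[ℂ] A} (ρ : CovariantRep α) :
    CStarAlgebra ρ.Op where

/-- The bounded families of operators indexed by all covariant representations of `(ℤ, A, α)`,
that is, the block-diagonal operators on the direct sum of all of these representations. -/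
abbrev UniversalOp (α : A ≃⋆ₐ[ℂ] A) : Type (u + 1) :=
  lp (fun ρ : CovariantRep α => ρ.Op) ∞

/-- The image of `a ∈ A` in the universal covariant representation: the family `(π(a))` over all
covariant representations `(π, U)`. -/
def universalCoeff (α : A ≃⋆ₐ[ℂ] A) (a : A) : UniversalOp α :=
  ⟨fun ρ => ρ.π a, memℓp_infty ⟨‖a‖, by
    rintro _ ⟨ρ, rfl⟩
    exact NonUnitalStarAlgHom.norm_apply_le ρ.π a⟩⟩

/-- The unitary of the universal covariant representation: the family `(U)` over all covariant
representations `(π, U)`. -/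
def universalUnitary (α : A ≃⋆ₐ[ℂ] A) : UniversalOp α :=
  ⟨fun ρ => (ρ.U : ρ.Op), memℓp_infty ⟨1, by
    rintro _ ⟨ρ, rfl⟩
    exact CStarRing.norm_coe_unitary ρ.U |>.le⟩⟩

/-- The (full) crossed product `C⋆(ℤ, A, α)`: the C⋆-algebra generated by the universal covariant
representation, that is, the norm closure of the ⋆-algebra of the finite sums `∑ₖ aₖ uᵏ`, where
`‖∑ₖ aₖ uᵏ‖` is the supremum of `‖∑ₖ π(aₖ) Uᵏ‖` over all covariant representations `(π, U)` of
`(ℤ, A, α)`. -/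
def crossedProduct (α : A ≃⋆ₐ[ℂ] A) : StarSubalgebra ℂ (UniversalOp α) :=
  (StarAlgebra.adjoin ℂ (Set.range (universalCoeff α) ∪ {universalUnitary α})).topologicalClosure

instance crossedProduct.instIsClosed (α : A ≃⋆ₐ[ℂ] A) :
    IsClosed (crossedProduct α : Set (UniversalOp α)) :=
  StarSubalgebra.isClosed_topologicalClosure _

instance crossedProduct.instCStarAlgebra (α : A ≃⋆ₐ[ℂ] A) : CStarAlgebra (crossedProduct α) :=
  StarSubalgebra.cstarAlgebra (crossedProduct α)

/-- A unital C⋆-algebra is simple if it is non-zero and its only closed two-sided ideals are `0`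
and the whole algebra. -/
def IsSimpleCStarAlgebra (B : Type*) [CStarAlgebra B] : Prop :=
  Nontrivial B ∧ ∀ I : TwoSidedIdeal B, IsClosed (I : Set B) → I = ⊥ ∨ I = ⊤

/-- `A` is `α`-simple if it is non-zero and its only `α`-invariant closed two-sided ideals `I`
(`α(I) = I`) are `0` and `A`. -/
def IsAlphaSimple (α : A ≃⋆ₐ[ℂ] A) : Prop :=
  Nontrivial A ∧ ∀ I : TwoSidedIdeal A, IsClosed (I : Set A) → α '' (I : Set A) = (I : Set A) →
    I = ⊥ ∨ I = ⊤

/-- The tracial quasi-Rokhlin property of an automorphism `α` of a unital C⋆-algebra. -/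
def HasTracialQuasiRokhlinProperty [PartialOrder A] [StarOrderedRing A]
    (α : A ≃⋆ₐ[ℂ] A) : Prop :=
  ∀ ε : ℝ, 0 < ε → ∀ F : Finset A, ∀ n : ℕ, ∀ x : A, 0 ≤ x → ‖x‖ = 1 →
    ∃ c : Fin (n + 1) → A,
      (∀ j, 0 ≤ c j ∧ c j ≤ 1) ∧
      (∀ j k, j ≠ k → c j * c k = 0) ∧
      (∀ j : Fin n, ‖α (c j.castSucc) - c j.succ‖ < ε) ∧
      (∀ j, ∀ a ∈ F, ‖c j * a - a * c j‖ < ε) ∧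
      (∃ (N : ℕ) (e : Fin (N + 1) → A) (w : Fin (N + 1) → unitary A) (d : Fin (N + 1) → ℤ),
        (∀ j, 0 ≤ e j) ∧
        1 - ∑ j, c j ≤ ∑ j, e j ∧
        (∀ j k, j ≠ k →
          ((w j : A) * (α ^ d j) (e j) * star (w j : A)) *
            ((w k : A) * (α ^ d k) (e k) * star (w k : A)) = 0) ∧
        (∀ j, (w j : A) * (α ^ d j) (e j) * star (w j : A) ∈
          closure (Set.range fun a : A => x * a * x))) ∧
      1 - ε < ‖(∑ j, c j) * x * ∑ j, c j‖

end Dynamics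

end

/-! Let `J` be a non-zero closed ideal of the crossed product `B`. The elements of `A` that land in
`J` form an `α`-invariant closed ideal, so either `1 ∈ J` or `J` misses every non-zero element of
`A`. The second case has to be excluded.

Take `y ≠ 0` in `J` and approximate `star y * y` by a finite sum `∑ gₖ uᵏ`. Faithfulness of the
zeroth Fourier coefficient (`IsGaugeFamily.exists_le_norm_coeff_zero`) keeps `‖g₀‖` bounded below. A
Rokhlin tower `c₀, …, cₙ` almost commutes with the `gₖ`, and `α` nearly shifts it, so each `cⱼ gₖ uᵏ
cⱼ` with `k ≠ 0` is small (`norm_compress_laurentSum_sub_le`). Hence `∑ cⱼ (star y * y) cⱼ`, which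
lies in `J`, is close to `s g₀ s` with `s = ∑ cⱼ`, and condition (6) makes `‖s g₀ s‖` larger than
the error. Functional calculus then produces a non-zero element of `A` inside `J`
(`TwoSidedIdeal.exists_ne_zero_map_mem`), a contradiction.

The conditional expectation is never constructed: averages of the gauge action over roots of unity
replace the integral over the circle. That the crossed product is non-zero needs a covariant
representation on a non-zero space. It comes from the GNS construction for an `α`-invariant state,
which Hahn–Banach provides. -/

noncomputable section

/-! ### Finite Laurent sums in a covariant pair, and their density. -/

section Laurent

variable {A B : Type*} [CStarAlgebra A] [CStarAlgebra B]

/-- The finite sum `∑ₖ φ(f(k)) uᵏ`. -/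
def laurentSum (φ : A →⋆ₐ[ℂ] B) (u : unitary B) (f : ℤ →₀ A) : B :=
  f.sum fun k a => φ a * ((u ^ k : unitary B) : B)

variable {α : A ≃⋆ₐ[ℂ] A} {φ : A →⋆ₐ[ℂ] B} {u : unitary B}

theorem unitary_mul_of_covariant (hu : ∀ a, φ (α a) = u * φ a * star (u : B)) (a : A) :
    (u : B) * φ a = φ (α a) * u := by
  rw [hu, mul_assoc _ (star _), Unitary.coe_star_mul_self, mul_one]

theorem unitary_star_mul_of_covariant (hu : ∀ a, φ (α a) = u * φ a * star (u : B)) (a : A) :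
    star (u : B) * φ a = φ (α⁻¹ a) * star (u : B) := by
  have h1 := unitary_mul_of_covariant hu (α⁻¹ a)
  have h2 : α (α⁻¹ a) = a := α.apply_symm_apply a
  rw [h2] at h1
  calc star (u : B) * φ a
      = star (u : B) * (φ a * u) * star (u : B) := by
        rw [mul_assoc, mul_assoc, Unitary.mul_star_self_of_mem u.2, mul_one]
    _ = _ := by
        rw [← h1, ← mul_assoc, Unitary.coe_star_mul_self, one_mul]

theorem unitary_zpow_mul_of_covariant (hu : ∀ a, φ (α a) = u * φ a * star (u : B)) (k : ℤ)
    (a : A) : ((u ^ k : unitary B) : B) * φ a = φ ((α ^ k) a) * ((u ^ k : unitary B) : B) := by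
  induction k generalizing a with
  | zero => simp
  | succ n ih =>
    rw [zpow_add_one, zpow_add_one, Submonoid.coe_mul, mul_assoc, unitary_mul_of_covariant hu,
      ← mul_assoc, ih, mul_assoc]
    rfl
  | pred n ih =>
    rw [zpow_sub_one, zpow_sub_one, Submonoid.coe_mul, ← Unitary.star_eq_inv, Unitary.coe_star,
      mul_assoc, unitary_star_mul_of_covariant hu, ← mul_assoc, ih, mul_assoc]
    rfl

theorem laurentSum_single (k : ℤ) (a : A) :
    laurentSum φ u (Finsupp.single k a) = φ a * ((u ^ k : unitary B) : B) :=
  Finsupp.sum_single_index (by simp)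

theorem laurentSum_zero : laurentSum φ u 0 = 0 := Finsupp.sum_zero_index

theorem laurentSum_add (f g : ℤ →₀ A) :
    laurentSum φ u (f + g) = laurentSum φ u f + laurentSum φ u g :=
  Finsupp.sum_add_index' (by simp) (by simp [add_mul])

theorem exists_laurentSum_eq_mul (hu : ∀ a, φ (α a) = u * φ a * star (u : B)) (f g : ℤ →₀ A) :
    ∃ h, laurentSum φ u f * laurentSum φ u g = laurentSum φ u h := by
  induction f using Finsupp.induction_linear with
  | zero => exact ⟨0, by simp [laurentSum_zero]⟩
  | add f₁ f₂ h₁ h₂ =>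
    obtain ⟨a, ha⟩ := h₁
    obtain ⟨b, hb⟩ := h₂
    exact ⟨a + b, by rw [laurentSum_add, laurentSum_add, add_mul, ha, hb]⟩
  | single k a =>
    induction g using Finsupp.induction_linear with
    | zero => exact ⟨0, by simp [laurentSum_zero]⟩
    | add f₁ f₂ h₁ h₂ =>
      obtain ⟨a, ha⟩ := h₁
      obtain ⟨b, hb⟩ := h₂
      exact ⟨a + b, by rw [laurentSum_add, laurentSum_add, mul_add, ha, hb]⟩
    | single l b =>
      refine ⟨Finsupp.single (k + l) (a * (α ^ k) b), ?_⟩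
      rw [laurentSum_single, laurentSum_single, laurentSum_single, map_mul, zpow_add,
        Submonoid.coe_mul, mul_assoc, ← mul_assoc _ (φ b), unitary_zpow_mul_of_covariant hu]
      simp only [mul_assoc]

theorem exists_laurentSum_eq_star (hu : ∀ a, φ (α a) = u * φ a * star (u : B)) (f : ℤ →₀ A) :
    ∃ h, star (laurentSum φ u f) = laurentSum φ u h := by
  induction f using Finsupp.induction_linear with
  | zero => exact ⟨0, by simp [laurentSum_zero]⟩
  | add f₁ f₂ h₁ h₂ =>
    obtain ⟨a, ha⟩ := h₁
    obtain ⟨b, hb⟩ := h₂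
    exact ⟨a + b, by rw [laurentSum_add, laurentSum_add, star_add, ha, hb]⟩
  | single k a =>
    refine ⟨Finsupp.single (-k) ((α ^ (-k)) (star a)), ?_⟩
    rw [laurentSum_single, laurentSum_single, ← unitary_zpow_mul_of_covariant hu, star_mul,
      ← map_star, ← Unitary.coe_star, Unitary.star_eq_inv, zpow_neg]

theorem exists_laurentSum_eq_of_mem_adjoin (hu : ∀ a, φ (α a) = u * φ a * star (u : B)) {p : B}
    (hp : p ∈ StarAlgebra.adjoin ℂ (Set.range φ ∪ {(u : B)})) : ∃ f, p = laurentSum φ u f := by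
  induction hp using StarAlgebra.adjoin_induction with
  | mem x hx =>
    rcases hx with ⟨a, rfl⟩ | hx
    · exact ⟨Finsupp.single 0 a, by simp [laurentSum_single]⟩
    · rw [Set.mem_singleton_iff] at hx
      exact ⟨Finsupp.single 1 1, by simp [laurentSum_single, hx]⟩
  | algebraMap r =>
    refine ⟨Finsupp.single 0 (algebraMap ℂ A r), ?_⟩
    rw [laurentSum_single, AlgHomClass.commutes]
    simp
  | add x y _ _ hx hy =>
    obtain ⟨f, rfl⟩ := hx
    obtain ⟨g, rfl⟩ := hy
    exact ⟨f + g, (laurentSum_add f g).symm⟩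
  | mul x y _ _ hx hy =>
    obtain ⟨f, rfl⟩ := hx
    obtain ⟨g, rfl⟩ := hy
    exact exists_laurentSum_eq_mul hu f g
  | star x _ hx =>
    obtain ⟨f, rfl⟩ := hx
    exact exists_laurentSum_eq_star hu f

theorem exists_norm_sub_laurentSum_lt (hu : ∀ a, φ (α a) = u * φ a * star (u : B))
    (hd : Dense (StarAlgebra.adjoin ℂ (Set.range φ ∪ {(u : B)}) : Set B)) (b : B) {ε : ℝ}
    (hε : 0 < ε) : ∃ f, ‖b - laurentSum φ u f‖ < ε := by
  obtain ⟨p, hp, hbp⟩ := Metric.mem_closure_iff.mp (hd b) ε hε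
  obtain ⟨f, rfl⟩ := exists_laurentSum_eq_of_mem_adjoin hu hp
  exact ⟨f, by rwa [dist_eq_norm] at hbp⟩

end Laurent

/-- Compressing `a` by its negative part gives `a⁻ a a⁻ = -(a⁻)³`. Its image is both positive and
negative, so injectivity forces `(a⁻)³ = 0` and then `a⁻ = 0`. -/
theorem nonneg_of_map_nonneg {A B : Type*} [CStarAlgebra A] [PartialOrder A] [StarOrderedRing A]
    [CStarAlgebra B] [PartialOrder B] [StarOrderedRing B] (φ : A →⋆ₐ[ℂ] B)
    (hφ : Function.Injective φ) {a : A} (ha : 0 ≤ φ a) : 0 ≤ a := by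
  have hs : IsSelfAdjoint a := hφ (by rw [map_star, (IsSelfAdjoint.of_nonneg ha).star_eq])
  have hn : star (a⁻) = a⁻ := IsSelfAdjoint.of_nonneg (CFC.negPart_nonneg a)
  have h1 : a⁻ * a * a⁻ = -(a⁻ * a⁻ * a⁻) := by
    have : a⁻ * a = -(a⁻ * a⁻) := by
      nth_rw 2 [← CFC.posPart_sub_negPart a hs]
      rw [mul_sub, CFC.negPart_mul_posPart, zero_sub]
    rw [this, neg_mul]
  have h2 : 0 ≤ φ (a⁻ * a * a⁻) := by
    have := star_left_conjugate_nonneg ha (φ a⁻)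
    rwa [← map_star, hn, ← map_mul, ← map_mul] at this
  have h3 : 0 ≤ φ (a⁻ * a⁻ * a⁻) := by
    refine map_nonneg φ ?_
    have := star_left_conjugate_nonneg (CFC.negPart_nonneg a) a⁻
    rwa [hn] at this
  rw [h1, map_neg] at h2
  have h4 : a⁻ * a⁻ * a⁻ = 0 :=
    hφ (by rw [map_zero]; exact le_antisymm (neg_nonneg.mp h2) h3)
  have h5 : a⁻ * a⁻ = 0 := by
    refine CStarRing.star_mul_self_eq_zero_iff _ |>.mp ?_
    rw [star_mul, hn, ← mul_assoc, h4, zero_mul]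
  have h6 : a⁻ = 0 := by
    refine CStarRing.star_mul_self_eq_zero_iff _ |>.mp ?_
    rw [hn, h5]
  rw [← CFC.posPart_sub_negPart a hs, h6, sub_zero]
  exact CFC.posPart_nonneg a

/-! ### Gauge actions and faithfulness of the zeroth Fourier coefficient. -/

section Gauge

variable {A B V : Type*} [CStarAlgebra A] [CStarAlgebra B] [CStarAlgebra V]

/-- A family of ⋆-homomorphisms, indexed by the circle, that fixes the coefficients and
multiplies the unitary by the scalars of the circle. -/
structure IsGaugeFamily (φ : A →⋆ₐ[ℂ] B) (u : unitary B) (γ : Circle → B →⋆ₐ[ℂ] V) : Prop where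
  map_coeff : ∀ z a, γ z (φ a) = γ 1 (φ a)
  map_unitary : ∀ z, γ z u = (z : ℂ) • γ 1 u
  -- The target `V` may be larger than `B`, so `γ` need not preserve `B`; `γ 1` then plays the role
  -- of the inclusion, and injectivity makes it isometric.
  injective : Function.Injective (γ 1)

namespace IsGaugeFamily

variable {φ : A →⋆ₐ[ℂ] B} {u : unitary B} {γ : Circle → B →⋆ₐ[ℂ] V}

theorem map_zpow (h : IsGaugeFamily φ u γ) (z : Circle) (k : ℤ) :
    γ z ((u ^ k : unitary B) : B) = (z : ℂ) ^ k • γ 1 ((u ^ k : unitary B) : B) := by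
  have hz : (z : ℂ) ≠ 0 := z.coe_ne_zero
  have hstar : star (z : ℂ) = (z : ℂ)⁻¹ := by
    rw [← Circle.coe_inv, Circle.coe_inv_eq_conj]; rfl
  induction k with
  | zero => simp
  | succ n ih =>
    rw [zpow_add_one, zpow_add_one₀ hz, Submonoid.coe_mul, map_mul, map_mul, ih, h.map_unitary,
      smul_mul_smul_comm]
  | pred n ih =>
    rw [zpow_sub_one, zpow_sub_one₀ hz, Submonoid.coe_mul, map_mul, map_mul, ih,
      ← Unitary.star_eq_inv, Unitary.coe_star, map_star, map_star, h.map_unitary, star_smul, hstar,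
      smul_mul_smul_comm]

theorem map_laurentSum (h : IsGaugeFamily φ u γ) (z : Circle) (f : ℤ →₀ A) :
    γ z (laurentSum φ u f) =
      f.sum fun k a => (z : ℂ) ^ k • γ 1 (φ a * ((u ^ k : unitary B) : B)) := by
  rw [laurentSum, map_finsuppSum]
  refine Finsupp.sum_congr fun k _ => ?_
  rw [map_mul, map_mul, h.map_coeff, h.map_zpow, mul_smul_comm]

/-- On Laurent sums the orbit is a trigonometric polynomial in `z`. Since each `γ z` is contractive,
approximation by Laurent sums is uniform in `z`. -/
theorem continuous_apply (h : IsGaugeFamily φ u γ)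
    (hd : ∀ b : B, ∀ ε > 0, ∃ f, ‖b - laurentSum φ u f‖ < ε) (b : B) :
    Continuous fun z => γ z b := by
  refine continuous_of_uniform_approx_of_continuous (f := fun z => γ z b) fun U hU => ?_
  obtain ⟨ε, hε, hU⟩ := Metric.mem_uniformity_dist.mp hU
  obtain ⟨f, hf⟩ := hd b ε hε
  refine ⟨fun z => γ z (laurentSum φ u f), ?_, fun z => hU ?_⟩
  · simp only [h.map_laurentSum, Finsupp.sum]
    refine continuous_finsetSum _ fun k _ => ?_
    exact (continuous_subtype_val.zpow₀ k fun z => Or.inl (Circle.coe_ne_zero z)).smul continuous_const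
  · rw [dist_eq_norm, ← map_sub]
    exact (NonUnitalStarAlgHom.norm_apply_le (γ z) _).trans_lt hf

/-- Averaging over the `m`-th roots of unity extracts the constant coefficient. -/
theorem sum_laurentSum (h : IsGaugeFamily φ u γ) {f : ℤ →₀ A} {m : ℕ} (hm : m ≠ 0)
    (hf : ∀ k ∈ f.support, |k| < m) :
    ∑ j ∈ Finset.range m, γ (Circle.exp (2 * Real.pi / m * j)) (laurentSum φ u f) =
      (m : ℂ) • γ 1 (φ (f 0)) := by
  have hζ := Complex.isPrimitiveRoot_exp m hm
  have hz : ∀ j : ℕ, ∀ k : ℤ, ((Circle.exp (2 * Real.pi / m * j) : Circle) : ℂ) ^ k =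
      (Complex.exp (2 * Real.pi * Complex.I / m) ^ k) ^ j := by
    intro j k
    rw [← zpow_natCast, zpow_comm, zpow_natCast, Circle.coe_exp, ← Complex.exp_nat_mul]
    congr 2
    push_cast
    ring
  simp only [h.map_laurentSum, Finsupp.sum, hz]
  rw [Finset.sum_comm]
  simp only [← Finset.sum_smul]
  rw [Finset.sum_eq_single 0]
  · simp
  · intro k hk hk0
    -- As `0 < |k| < m`, the `k`-th power of a primitive `m`-th root of unity is not `1`, so its
    -- geometric sum over a full period vanishes.
    have h1 : Complex.exp (2 * Real.pi * Complex.I / m) ^ k ≠ 1 := by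
      rw [Ne, hζ.zpow_eq_one_iff_dvd]
      exact fun hdvd => hk0 (Int.eq_zero_of_abs_lt_dvd hdvd (hf k hk))
    have h2 : (Complex.exp (2 * Real.pi * Complex.I / m) ^ k) ^ m = 1 := by
      rw [← zpow_natCast, zpow_comm, zpow_natCast, hζ.pow_eq_one, one_zpow]
    have h3 := geom_sum_mul (Complex.exp (2 * Real.pi * Complex.I / m) ^ k) m
    rw [h2, sub_self, mul_eq_zero, or_iff_left (sub_ne_zero.mpr h1)] at h3
    rw [h3, zero_smul]
  · intro h0
    rw [Finsupp.notMem_support_iff.mp h0]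
    simp

theorem exists_forall_mem_support_abs_lt (f : ℤ →₀ A) :
    ∃ m : ℕ, m ≠ 0 ∧ ∀ k ∈ f.support, |k| < m := by
  refine ⟨f.support.sup Int.natAbs + 1, by omega, fun k hk => ?_⟩
  have := Finset.le_sup (f := Int.natAbs) hk
  rw [Int.abs_eq_natAbs]
  omega

/-- The constant coefficient of a positive Laurent sum is positive. -/
theorem coeff_zero_nonneg [PartialOrder A] [StarOrderedRing A] (h : IsGaugeFamily φ u γ)
    (hφ : Function.Injective φ) {g : ℤ →₀ A} {p : B} (hp : laurentSum φ u g = star p * p) :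
    0 ≤ g 0 := by
  let _ : PartialOrder V := CStarAlgebra.spectralOrder V
  have _ : StarOrderedRing V := CStarAlgebra.spectralOrderedRing V
  obtain ⟨m, hm, hg⟩ := exists_forall_mem_support_abs_lt g
  refine nonneg_of_map_nonneg ((γ 1).comp φ) (h.injective.comp hφ) ?_
  have h1 := h.sum_laurentSum hm hg
  have h2 : 0 ≤ (m : ℂ) • γ 1 (φ (g 0)) := by
    rw [← h1]
    refine Finset.sum_nonneg fun j _ => ?_
    rw [hp, map_mul, map_star]
    exact star_mul_self_nonneg _
  have h3 : γ 1 (φ (g 0)) = (m : ℝ)⁻¹ • ((m : ℂ) • γ 1 (φ (g 0))) := by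
    rw [← Complex.coe_smul, smul_smul]
    push_cast
    rw [inv_mul_cancel₀ (by exact_mod_cast hm), one_smul]
  change 0 ≤ γ 1 (φ (g 0))
  rw [h3]
  exact smul_nonneg (by positivity) h2

/-- The Fourier coefficient at `0` is faithful. -/
theorem exists_le_norm_coeff_zero (h : IsGaugeFamily φ u γ)
    (hd : ∀ b : B, ∀ ε > 0, ∃ f, ‖b - laurentSum φ u f‖ < ε) {y : B} (hy : y ≠ 0) :
    ∃ κ > 0, ∀ g, κ ≤ ‖g 0‖ + ‖star y * y - laurentSum φ u g‖ := by
  let _ : PartialOrder V := CStarAlgebra.spectralOrder V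
  have _ : StarOrderedRing V := CStarAlgebra.spectralOrderedRing V
  set b := star y * y with hb
  have hb0 : 0 < ‖b‖ := norm_pos_iff.mpr ((CStarRing.star_mul_self_ne_zero_iff _).mpr hy)
  have hγ : ∀ z, 0 ≤ γ z b := fun z => by
    rw [hb, map_mul, map_star]; exact star_mul_self_nonneg _
  have hcont : Continuous fun x : ℝ => γ (Circle.exp x) b :=
    (h.continuous_apply hd b).comp Circle.exp.continuous
  obtain ⟨δ, hδ, hδb⟩ := Metric.continuous_iff.mp hcont 0 (‖b‖ / 2) (by positivity)
  simp only [Circle.exp_zero, dist_zero_right, dist_eq_norm (γ _ b)] at hδb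
  -- An arc of length `2π / L < δ` starting at `1` is one on which `γ z b` stays within `‖b‖ / 2` of
  -- `γ 1 b`. This `L` does not depend on `g`, hence neither does `κ = ‖b‖ / (2L)`.
  obtain ⟨L, hL⟩ := exists_nat_gt (2 * Real.pi / δ)
  have hL0 : (0 : ℝ) < L := lt_trans (by positivity) hL
  refine ⟨‖b‖ / (2 * L), by positivity, fun g => ?_⟩
  obtain ⟨t, ht, hg⟩ := exists_forall_mem_support_abs_lt g
  have ht0 : (0 : ℝ) < t := by positivity
  have hL1 : 1 ≤ L := by exact_mod_cast hL0
  -- Averaging over `L * t` roots of unity does two jobs: the order exceeds the degree of `g`, and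
  -- exactly the first `t` roots, a proportion `1 / L`, fall in the arc.
  have hm : L * t ≠ 0 := by positivity
  have hg' : ∀ k ∈ g.support, |k| < ((L * t : ℕ) : ℤ) := fun k hk =>
    (hg k hk).trans_le (by exact_mod_cast Nat.le_mul_of_pos_left t hL1)
  set z : ℕ → Circle := fun j => Circle.exp (2 * Real.pi / (L * t : ℕ) * j) with hz
  have h1 : ∑ j ∈ Finset.range (L * t), γ (z j) (laurentSum φ u g) = _ := h.sum_laurentSum hm hg'
  have h2 : ‖∑ j ∈ Finset.range (L * t), γ (z j) (b - laurentSum φ u g)‖ ≤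
      (L * t : ℕ) * ‖b - laurentSum φ u g‖ := by
    refine (norm_sum_le_of_le _ fun j _ =>
      NonUnitalStarAlgHom.norm_apply_le (γ (z j)) _).trans_eq ?_
    rw [Finset.sum_const, Finset.card_range, nsmul_eq_mul]
  -- All terms are positive, so those outside the arc cannot cancel those inside it.
  have h3 : ∑ j ∈ Finset.range t, γ (z j) b ≤ ∑ j ∈ Finset.range (L * t), γ (z j) b := by
    refine Finset.sum_le_sum_of_subset_of_nonneg ?_ fun j _ _ => hγ _
    exact Finset.range_mono (Nat.le_mul_of_pos_left t hL1)
  have h4 : ‖∑ j ∈ Finset.range t, γ (z j) b‖ ≤ ‖∑ j ∈ Finset.range (L * t), γ (z j) b‖ :=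
    CStarAlgebra.norm_le_norm_of_nonneg_of_le (Finset.sum_nonneg fun j _ => hγ _) h3
  have h5 : ‖∑ j ∈ Finset.range t, (γ (z j) b - γ 1 b)‖ ≤ t * (‖b‖ / 2) := by
    refine (norm_sum_le_of_le (n := fun _ => ‖b‖ / 2) _ fun j hj => ?_).trans_eq ?_
    · refine (hδb _ ?_).le
      have hj' : (j : ℝ) < t := by exact_mod_cast Finset.mem_range.mp hj
      rw [Real.norm_of_nonneg (by positivity)]
      rw [div_lt_iff₀ hδ] at hL
      push_cast
      rw [div_mul_eq_mul_div, div_lt_iff₀ (by positivity)]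
      calc 2 * Real.pi * j ≤ 2 * Real.pi * t := by gcongr
        _ < L * δ * t := by gcongr
        _ = δ * (L * t) := by ring
    · rw [Finset.sum_const, Finset.card_range, nsmul_eq_mul]
  rw [Finset.sum_sub_distrib, Finset.sum_const, Finset.card_range] at h5
  have h6 : ‖t • γ 1 b‖ = t * ‖b‖ := by
    rw [← Nat.cast_smul_eq_nsmul ℝ, norm_smul, NonUnitalStarAlgHom.norm_map (γ 1) h.injective]
    simp
  have h7 : ‖t • γ 1 b‖ ≤ ‖∑ j ∈ Finset.range t, γ (z j) b‖ +
      ‖∑ j ∈ Finset.range t, γ (z j) b - t • γ 1 b‖ := by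
    simpa using norm_sub_le (∑ j ∈ Finset.range t, γ (z j) b)
      (∑ j ∈ Finset.range t, γ (z j) b - t • γ 1 b)
  have h8 : ‖((L * t : ℕ) : ℂ) • γ 1 (φ (g 0))‖ ≤ (L * t : ℕ) * ‖g 0‖ := by
    rw [norm_smul, Complex.norm_natCast]
    gcongr
    exact (NonUnitalStarAlgHom.norm_apply_le (γ 1) _).trans
      (NonUnitalStarAlgHom.norm_apply_le φ _)
  have h9 : ‖∑ j ∈ Finset.range (L * t), γ (z j) b‖ ≤
      (L * t : ℕ) * ‖g 0‖ + (L * t : ℕ) * ‖b - laurentSum φ u g‖ := by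
    refine le_trans ?_ (add_le_add h8 h2)
    rw [← h1]
    refine le_trans (le_of_eq ?_) (norm_add_le _ _)
    simp only [map_sub, Finset.sum_sub_distrib, add_sub_cancel]
  rw [div_le_iff₀ (by positivity)]
  push_cast at h9
  have h10 : t * (‖b‖ / 2) ≤ t * (L * (‖g 0‖ + ‖b - laurentSum φ u g‖)) := by
    nlinarith
  have := le_of_mul_le_mul_left h10 ht0
  linarith

end IsGaugeFamily

end Gauge

/-! ### Closed ideals, functional calculus and compressions by orthogonal contractions. -/

section CStarLemmas

variable {B : Type*} [CStarAlgebra B] [PartialOrder B] [StarOrderedRing B]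

/-- Closed ideals of C⋆-algebras are hereditary: if `p⋆p ≤ q ∈ J` then `p ∈ J`. -/
theorem TwoSidedIdeal.mem_of_star_mul_self_le {J : TwoSidedIdeal B} (hJ : IsClosed (J : Set B))
    {p q : B} (hq : q ∈ J) (hpq : star p * p ≤ q) : p ∈ J := by
  have hq0 : 0 ≤ q := (star_mul_self_nonneg p).trans hpq
  have hsp : ∀ x ∈ spectrum ℝ q, 0 ≤ x := fun x hx => spectrum_nonneg_of_nonneg hq0 hx
  refine hJ.closure_subset_iff.mpr subset_rfl (Metric.mem_closure_iff.mpr fun ε hε => ?_)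
  set t : ℝ := (ε / 2) ^ 2 with ht_def
  have ht : 0 < t := by positivity
  have hc : ContinuousOn (fun x : ℝ => t / (x + t)) (spectrum ℝ q) :=
    continuousOn_const.div (by fun_prop) fun x hx => by have := hsp x hx; positivity
  have hc' : ContinuousOn (fun x : ℝ => 1 / (x + t)) (spectrum ℝ q) :=
    continuousOn_const.div (by fun_prop) fun x hx => by have := hsp x hx; positivity
  -- Here `r = t (q + t)⁻¹`, so `1 - r` is a multiple of `q` and lies in `J`, while `‖p r‖² ≤ ‖r q
  -- r‖ ≤ t`. Thus `p (1 - r) ∈ J` is within `√t = ε / 2` of `p`.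
  set r : B := cfc (fun x : ℝ => t / (x + t)) q with hr
  have hr_sa : star r = r := (IsSelfAdjoint.cfc (f := fun x : ℝ => t / (x + t)) (a := q))
  have h1 : 1 - r = q * cfc (fun x : ℝ => 1 / (x + t)) q := by
    have : q * cfc (fun x : ℝ => 1 / (x + t)) q =
        cfc (fun x : ℝ => x * (1 / (x + t))) q := by
      rw [cfc_mul (fun x : ℝ => x) (fun x : ℝ => 1 / (x + t)) q (by fun_prop) hc',
        cfc_id' ℝ q]
    rw [this, ← cfc_one ℝ q, hr]
    rw [← cfc_sub (1 : ℝ → ℝ) (fun x : ℝ => t / (x + t)) q (by fun_prop) hc]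
    refine cfc_congr fun x hx => ?_
    have := hsp x hx
    simp only [Pi.one_apply]
    field_simp
    ring
  have h2 : ‖r * q * r‖ ≤ t := by
    have : r * q * r = cfc (fun x : ℝ => t / (x + t) * x * (t / (x + t))) q := by
      rw [cfc_mul (fun x : ℝ => t / (x + t) * x) _ q (hc.mul continuousOn_id) hc,
        cfc_mul _ (fun x : ℝ => x) q hc (by fun_prop), cfc_id' ℝ q]
    rw [this]
    refine norm_cfc_le ht.le fun x hx => ?_
    have := hsp x hx
    rw [Real.norm_of_nonneg (by positivity)]
    rw [show t / (x + t) * x * (t / (x + t)) = t * (t * x / (x + t) ^ 2) by field_simp]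
    refine mul_le_of_le_one_right ht.le ?_
    rw [div_le_one (by positivity)]
    nlinarith
  refine ⟨p * (1 - r), ?_, ?_⟩
  · exact J.mul_mem_left _ _ (h1 ▸ J.mul_mem_right _ _ hq)
  · have h3 : ‖p * r‖ ^ 2 ≤ t := by
      rw [sq, ← CStarRing.norm_star_mul_self]
      refine le_trans ?_ h2
      have h4 : star (p * r) * (p * r) ≤ r * q * r := by
        have := star_left_conjugate_le_conjugate hpq r
        rw [hr_sa] at this
        simpa [hr_sa, mul_assoc] using this
      exact CStarAlgebra.norm_le_norm_of_nonneg_of_le (star_mul_self_nonneg _) h4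
    rw [dist_eq_norm, show p - p * (1 - r) = p * r by noncomm_ring]
    have := abs_le_of_sq_le_sq h3 (by positivity)
    rw [abs_of_nonneg (norm_nonneg _)] at this
    linarith

/-- A closed ideal that comes close to the image of a positive element contains the image of a
non-zero element. -/
theorem TwoSidedIdeal.exists_ne_zero_map_mem {A : Type*} [CStarAlgebra A] [PartialOrder A]
    [StarOrderedRing A] (φ : A →⋆ₐ[ℂ] B) {J : TwoSidedIdeal B} (hJ : IsClosed (J : Set B))
    {a : A} (ha : 0 ≤ a) {q : B} (hq : q ∈ J) (hqs : IsSelfAdjoint q) (h : ‖φ a - q‖ < ‖a‖) :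
    ∃ f : A, f ≠ 0 ∧ φ f ∈ J := by
  have hA : Nontrivial A := by
    by_contra hn
    rw [not_nontrivial_iff_subsingleton] at hn
    simp [Subsingleton.elim a 0] at h
    exact absurd h (norm_nonneg _).not_gt
  obtain ⟨δ, hδ1, hδ2⟩ := exists_between h
  -- The cut-off `(a - δ)₊` is non-zero because `δ < ‖a‖`, and on its support `a` dominates `δ`. As
  -- `δ > ‖φ a - q‖`, the element `φ f * q * φ f` of `J` dominates a positive multiple of `(φ f)²`,
  -- and closed ideals are hereditary.
  set f : A := cfc (fun x : ℝ => max (x - δ) 0) a with hf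
  have hfs : star f = f := (IsSelfAdjoint.cfc (f := fun x : ℝ => max (x - δ) 0) (a := a))
  have hf1 : δ • (f * f) ≤ f * a * f := by
    have e1 : f * a * f =
        cfc (fun x : ℝ => max (x - δ) 0 * x * max (x - δ) 0) a := by
      rw [cfc_mul (fun x : ℝ => max (x - δ) 0 * x) _ a (by fun_prop) (by fun_prop),
        cfc_mul _ (fun x : ℝ => x) a (by fun_prop) (by fun_prop), cfc_id' ℝ a]
    have e2 : δ • (f * f) = cfc (fun x : ℝ => δ • (max (x - δ) 0 * max (x - δ) 0)) a := by
      rw [cfc_smul δ _ a (by fun_prop), cfc_mul _ _ a (by fun_prop) (by fun_prop)]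
    rw [e1, e2]
    refine cfc_mono (fun x _ => ?_) (by fun_prop) (by fun_prop)
    rcases le_total (x - δ) 0 with hx | hx
    · simp [max_eq_right hx]
    · rw [max_eq_left hx]
      simp only [smul_eq_mul]
      nlinarith [mul_nonneg hx (mul_self_nonneg (x - δ)), mul_self_nonneg (x - δ)]
  have hf0 : f ≠ 0 := by
    intro h0
    have hmem : max (‖a‖ - δ) 0 ∈ spectrum ℝ f := by
      rw [hf, cfc_map_spectrum (fun x : ℝ => max (x - δ) 0) a (by cfc_tac) (by fun_prop)]
      exact ⟨‖a‖, CStarAlgebra.norm_mem_spectrum_of_nonneg ha, rfl⟩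
    rw [h0, spectrum.zero_eq] at hmem
    have : max (‖a‖ - δ) 0 = 0 := hmem
    have h5 := le_max_left (‖a‖ - δ) 0
    linarith
  refine ⟨f, hf0, ?_⟩
  set s : ℝ := δ - ‖φ a - q‖ with hs
  have hs0 : 0 < s := by linarith
  have hφs : star (φ f) = φ f := by rw [← map_star, hfs]
  have k1 : φ a - q ≤ algebraMap ℝ B ‖φ a - q‖ :=
    IsSelfAdjoint.le_algebraMap_norm_self
      (((IsSelfAdjoint.of_nonneg ha).map φ).sub hqs)
  have k2 := star_left_conjugate_le_conjugate k1 (φ f)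
  have k3 : φ (δ • (f * f)) ≤ φ (f * a * f) := OrderHomClass.mono φ hf1
  have k3' : φ (δ • (f * f)) = δ • (φ f * φ f) := by
    rw [← map_mul, ← Complex.coe_smul, map_smul, Complex.coe_smul]
  have k4 : s • (φ f * φ f) ≤ φ f * q * φ f := by
    rw [hφs, Algebra.algebraMap_eq_smul_one, mul_smul_comm, mul_one, smul_mul_assoc, mul_sub,
      sub_mul, sub_le_iff_le_add] at k2
    rw [k3', map_mul, map_mul] at k3
    rw [hs, sub_smul, sub_le_iff_le_add, add_comm]
    exact k3.trans k2
  have hmem : (Real.sqrt s : ℝ) • φ f ∈ J := by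
    refine TwoSidedIdeal.mem_of_star_mul_self_le hJ
      (J.mul_mem_right _ (φ f) (J.mul_mem_left (φ f) _ hq)) ?_
    rw [star_smul, hφs, smul_mul_smul_comm]
    simpa [Real.mul_self_sqrt hs0.le] using k4
  have : φ f = algebraMap ℝ B (Real.sqrt s)⁻¹ * ((Real.sqrt s : ℝ) • φ f) := by
    rw [← Algebra.smul_def, smul_smul, inv_mul_cancel₀ (Real.sqrt_pos.mpr hs0).ne', one_smul]
  rw [this]
  exact J.mul_mem_left _ _ hmem

/-- The map `d ↦ ∑ cⱼ d cⱼ` is positive and sends `1` to a contraction, so it carries the bounds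
`-‖d‖ ≤ d ≤ ‖d‖` to its values. This avoids a factor equal to the number of terms. -/
theorem norm_sum_conjugate_le {ι : Type*} (s : Finset ι) {c : ι → B} (hc : ∀ j, 0 ≤ c j)
    (hc1 : ∑ j ∈ s, c j * c j ≤ 1) {d : B} (hd : IsSelfAdjoint d) :
    ‖∑ j ∈ s, c j * d * c j‖ ≤ ‖d‖ := by
  have hs : ∀ j, star (c j) = c j := fun j => IsSelfAdjoint.of_nonneg (hc j)
  have h1 : ‖d‖ • ∑ j ∈ s, c j * c j ≤ algebraMap ℝ B ‖d‖ := by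
    rw [Algebra.algebraMap_eq_smul_one]
    exact smul_le_smul_of_nonneg_left hc1 (norm_nonneg _)
  have key : ∀ x : B, x ≤ algebraMap ℝ B ‖d‖ →
      ∑ j ∈ s, c j * x * c j ≤ algebraMap ℝ B ‖d‖ := by
    intro x hx
    refine le_trans ?_ h1
    rw [Finset.smul_sum]
    refine Finset.sum_le_sum fun j _ => ?_
    have := star_left_conjugate_le_conjugate hx (c j)
    rwa [hs, Algebra.algebraMap_eq_smul_one, mul_smul_comm, mul_one, smul_mul_assoc] at this
  have hsa : IsSelfAdjoint (∑ j ∈ s, c j * d * c j) := by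
    rw [IsSelfAdjoint, star_sum]
    refine Finset.sum_congr rfl fun j _ => ?_
    rw [star_mul, star_mul, hs, hd.star_eq, mul_assoc]
  have k1 := key d (IsSelfAdjoint.le_algebraMap_norm_self hd)
  have k2 := key (-d) (by
    have := IsSelfAdjoint.neg_algebraMap_norm_le_self hd
    exact neg_le.mp this)
  have k3 : -algebraMap ℝ B ‖d‖ ≤ ∑ j ∈ s, c j * d * c j := by
    rw [neg_le]
    simpa using k2
  rw [← map_neg] at k3
  rcases subsingleton_or_nontrivial B with hB | hB
  · simp [Subsingleton.elim d 0]
  rcases CStarAlgebra.norm_or_neg_norm_mem_spectrum (a := ∑ j ∈ s, c j * d * c j) hsa with h | h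
  · exact (le_algebraMap_iff_spectrum_le (ha := hsa)).mp k1 _ h
  · exact neg_le_neg_iff.mp ((algebraMap_le_iff_le_spectrum (ha := hsa)).mp k3 _ h)

/-- The squares of pairwise orthogonal positive contractions sum to a contraction. -/
theorem sum_mul_self_le_one_of_orthogonal {ι : Type*} (s : Finset ι) {c : ι → B}
    (hc : ∀ j, 0 ≤ c j) (hc1 : ∀ j, c j ≤ 1) (ho : ∀ j k, j ≠ k → c j * c k = 0) :
    ∑ j ∈ s, c j * c j ≤ 1 := by
  classical
  have h0 : 0 ≤ ∑ j ∈ s, c j := Finset.sum_nonneg fun j _ => hc j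
  have h1 : (∑ j ∈ s, c j) * ∑ j ∈ s, c j = ∑ j ∈ s, c j * c j := by
    rw [Finset.sum_mul_sum]
    refine Finset.sum_congr rfl fun j hj => ?_
    exact Finset.sum_eq_single_of_mem j hj fun k _ hk => ho j k hk.symm
  have h2 : ∑ j ∈ s, c j * c j ≤ ∑ j ∈ s, c j := by
    refine Finset.sum_le_sum fun j _ => ?_
    have := CStarAlgebra.pow_antitone (hc j) (hc1 j) (show 1 ≤ 2 by norm_num)
    simpa [sq] using this
  -- For `s = ∑ cⱼ`, orthogonality gives `s² = ∑ cⱼ² ≤ s`, hence `‖s‖² ≤ ‖s‖`.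
  have h3 : ‖∑ j ∈ s, c j‖ ≤ 1 := by
    have h4 : ‖∑ j ∈ s, c j * c j‖ ≤ ‖∑ j ∈ s, c j‖ :=
      CStarAlgebra.norm_le_norm_of_nonneg_of_le
        (Finset.sum_nonneg fun j _ => by
          simpa [(IsSelfAdjoint.of_nonneg (hc j)).star_eq] using star_mul_self_nonneg (c j)) h2
    rw [← h1] at h4
    have h5 : ‖∑ j ∈ s, c j‖ * ‖∑ j ∈ s, c j‖ ≤ ‖∑ j ∈ s, c j‖ := by
      rw [← CStarRing.norm_star_mul_self, (IsSelfAdjoint.of_nonneg h0).star_eq]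
      exact h4
    by_contra hcon
    push Not at hcon
    nlinarith
  exact h2.trans ((CStarAlgebra.norm_le_one_iff_of_nonneg _ h0).mp h3)

end CStarLemmas

/-! ### Existence of invariant states. -/

section InvariantStates

open scoped ComplexOrder InnerProductSpace
open UniformSpace Completion

variable {A : Type u} [CStarAlgebra A]

/-- A norm-decreasing unital functional on a C⋆-algebra is positive. -/
theorem ContinuousLinearMap.apply_nonneg_of_norm_le_one [Nontrivial A] [PartialOrder A] [StarOrderedRing A]
    {f : A →L[ℂ] ℂ} (hf : ‖f‖ ≤ 1) (hf1 : f 1 = 1) {a : A} (ha : 0 ≤ a) : 0 ≤ f a := by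
  have hle : ∀ x : A, ‖f x‖ ≤ ‖x‖ := fun x => by
    simpa using f.le_of_opNorm_le hf x
  have hreal : ∀ h : A, IsSelfAdjoint h → (f h).im = 0 := by
    intro h hh
    -- Evaluate `f` at `h + it`: a non-zero imaginary part of `f h` would make the left side outgrow
    -- the right through the term linear in `t`.
    have key : ∀ t : ℝ, ((f h).im + t) ^ 2 ≤ ‖h‖ ^ 2 + t ^ 2 := by
      intro t
      have h1 : ‖h + (t * Complex.I : ℂ) • (1 : A)‖ ^ 2 ≤ ‖h‖ ^ 2 + t ^ 2 := by
        rw [sq, ← CStarRing.norm_star_mul_self]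
        have : star (h + (t * Complex.I : ℂ) • (1 : A)) * (h + (t * Complex.I : ℂ) • (1 : A)) =
            h * h + ((t ^ 2 : ℝ) : ℂ) • (1 : A) := by
          have e : star (t * Complex.I : ℂ) = -(t * Complex.I) := by simp
          have e2 : (t * Complex.I : ℂ) * (t * Complex.I) = -((t ^ 2 : ℝ) : ℂ) := by
            push_cast
            linear_combination (t : ℂ) ^ 2 * Complex.I_sq
          simp only [star_add, hh.star_eq, star_smul, star_one, add_mul, mul_add, smul_mul_assoc,
            mul_smul_comm, one_mul, mul_one, e, neg_smul, neg_mul, smul_neg, smul_add, smul_smul, e2,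
            neg_neg]
          abel
        rw [this]
        refine (norm_add_le _ _).trans (add_le_add ?_ ?_)
        · rw [sq]; exact norm_mul_le _ _
        · refine (norm_smul_le _ _).trans ?_
          rw [Complex.norm_real, Real.norm_of_nonneg (by positivity)]
          exact mul_le_of_le_one_right (by positivity) CStarRing.norm_one.le
      have h2 : ((f h).im + t) ^ 2 ≤ ‖f (h + (t * Complex.I : ℂ) • (1 : A))‖ ^ 2 := by
        rw [map_add, map_smul, hf1]
        have := Complex.abs_im_le_norm (f h + (t * Complex.I : ℂ) • (1 : ℂ))
        simp only [Complex.add_im, smul_eq_mul, mul_one, Complex.mul_im, Complex.ofReal_re,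
          Complex.I_im, Complex.ofReal_im, Complex.I_re, mul_zero, add_zero] at this
        rw [← sq_abs]
        simp only [smul_eq_mul, mul_one]
        gcongr
      exact h2.trans ((pow_le_pow_left₀ (norm_nonneg _) (hle _) 2).trans h1)
    by_contra hne
    have := key ((‖h‖ ^ 2 + 1) / (f h).im)
    have e : ((f h).im + (‖h‖ ^ 2 + 1) / (f h).im) ^ 2 =
        (f h).im ^ 2 + 2 * (‖h‖ ^ 2 + 1) + ((‖h‖ ^ 2 + 1) / (f h).im) ^ 2 := by
      field_simp
      ring
    nlinarith [sq_nonneg (f h).im, sq_nonneg ‖h‖]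
  have ha' : IsSelfAdjoint a := IsSelfAdjoint.of_nonneg ha
  rw [Complex.nonneg_iff]
  refine ⟨?_, (hreal a ha').symm⟩
  -- Applying `f` to `‖a‖ - a` gives `‖a‖ - Re (f a) ≤ ‖a‖`.
  have h1 : ‖algebraMap ℝ A ‖a‖ - a‖ ≤ ‖a‖ := by
    rw [CStarAlgebra.norm_le_iff_le_algebraMap _ (norm_nonneg a)
      (sub_nonneg.mpr (IsSelfAdjoint.le_algebraMap_norm_self ha'))]
    exact sub_le_self _ ha
  have h2 := hle (algebraMap ℝ A ‖a‖ - a)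
  rw [map_sub, Algebra.algebraMap_eq_smul_one, ← Complex.coe_smul, map_smul, hf1] at h2
  have h3 := Complex.re_le_norm ((‖a‖ : ℂ) • (1 : ℂ) - f a)
  rw [Algebra.algebraMap_eq_smul_one, ← Complex.coe_smul] at h1
  simp only [smul_eq_mul, mul_one, Complex.sub_re, Complex.ofReal_re] at h2 h3
  linarith

/-- The first `n` iterates of `α` on `1 + (b - α b)` telescope to `n + b - αⁿ b`, of norm at least
`n - 2‖b‖`. Dividing by `n` and letting it grow gives the bound. It says that `1` is at distance at
least `1` from the coboundaries. -/
theorem one_le_norm_one_add_sub_map [Nontrivial A] (α : A ≃⋆ₐ[ℂ] A) (b : A) :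
    1 ≤ ‖1 + (b - α b)‖ := by
  have hn : ∀ x : A, ‖α x‖ = ‖x‖ := fun x => NonUnitalStarAlgHom.norm_map α α.injective x
  have hpow : ∀ (k : ℕ) (x : A), ‖(α^[k]) x‖ = ‖x‖ := by
    intro k
    induction k with
    | zero => simp
    | succ k ih => intro x; rw [Function.iterate_succ_apply, ih, hn]
  have hsum : ∀ n : ℕ, (n : A) + (b - (α^[n]) b) =
      ∑ k ∈ Finset.range n, (α^[k]) (1 + (b - α b)) := by
    intro n
    induction n with
    | zero => simp
    | succ n ih =>
      rw [Finset.sum_range_succ, ← ih]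
      have : (α^[n]) (1 + (b - α b)) = 1 + ((α^[n]) b - (α^[n + 1]) b) := by
        have h1 : ∀ k : ℕ, (α^[k]) (1 + (b - α b)) = 1 + ((α^[k]) b - (α^[k]) (α b)) := by
          intro k
          induction k with
          | zero => simp
          | succ k ih => simp only [Function.iterate_succ_apply', ih, map_add, map_one, map_sub]
        rw [h1, Function.iterate_succ_apply]
      rw [this]
      push_cast
      abel
  have hbound : ∀ n : ℕ, (n : ℝ) * (1 - ‖1 + (b - α b)‖) ≤ 2 * ‖b‖ := by
    intro n
    have h1 : ‖(n : A) + (b - (α^[n]) b)‖ ≤ n * ‖1 + (b - α b)‖ := by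
      rw [hsum]
      refine (norm_sum_le _ _).trans ?_
      refine (Finset.sum_le_sum fun k _ => (hpow k _).le).trans ?_
      rw [Finset.sum_const, Finset.card_range, nsmul_eq_mul]
    have h2 : ‖(n : A)‖ ≤ ‖(n : A) + (b - (α^[n]) b)‖ + ‖b - (α^[n]) b‖ := by
      simpa using norm_sub_le ((n : A) + (b - (α^[n]) b)) (b - (α^[n]) b)
    have h3 : ‖b - (α^[n]) b‖ ≤ 2 * ‖b‖ := by
      refine (norm_sub_le _ _).trans ?_
      rw [hpow]; linarith
    have h4 : ‖(n : A)‖ = n := by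
      
      rw [← map_natCast (algebraMap ℝ A), norm_algebraMap, CStarRing.norm_one, mul_one]
      simp
    nlinarith
  by_contra hcon
  push Not at hcon
  obtain ⟨n, hn⟩ := exists_nat_gt (2 * ‖b‖ / (1 - ‖1 + (b - α b)‖))
  rw [div_lt_iff₀ (by linarith)] at hn
  linarith [hbound n]

/-- Every automorphism of a non-zero unital C⋆-algebra has an invariant state. -/
theorem exists_invariant_state [Nontrivial A] [PartialOrder A] [StarOrderedRing A]
    (α : A ≃⋆ₐ[ℂ] A) : ∃ f : A →ₚ[ℂ] ℂ, f 1 = 1 ∧ ∀ a, f (α a) = f a := by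
  let D : A →ₗ[ℂ] A := LinearMap.id - (α : A →⋆ₐ[ℂ] A).toAlgHom.toLinearMap
  have hD : ∀ b, D b = b - α b := fun b => rfl
  let S : Submodule ℂ A := LinearMap.range D
  have hone : ‖(S.mkQ 1 : A ⧸ S)‖ = 1 := by
    refine le_antisymm ((Submodule.Quotient.norm_mk_le S 1).trans CStarRing.norm_one.le) ?_
    refine le_of_forall_pos_le_add fun ε hε => ?_
    obtain ⟨m, hm, hm'⟩ := Submodule.Quotient.norm_mk_lt (S := S) (S.mkQ 1) hε
    have : m - 1 ∈ S := (Submodule.Quotient.eq S).mp hm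
    obtain ⟨b, hb⟩ := this
    rw [hD] at hb
    have := one_le_norm_one_add_sub_map α b
    rw [hb] at this
    simp only [add_sub_cancel] at this
    linarith
  -- A Hahn–Banach functional on the quotient by the coboundaries is automatically invariant; norm
  -- one together with value `1` at the unit makes it a state.
  obtain ⟨g, hg, hg1⟩ := exists_dual_vector ℂ (S.mkQ 1 : A ⧸ S) (by rw [hone]; exact one_ne_zero)
  let f : A →L[ℂ] ℂ := (g.toLinearMap ∘ₗ S.mkQ).mkContinuous 1 fun x => by
    refine (g.le_opNorm _).trans ?_
    rw [hg]
    gcongr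
    exact Submodule.Quotient.norm_mk_le S x
  have hf : ‖f‖ ≤ 1 := LinearMap.mkContinuous_norm_le _ zero_le_one _
  have hf1 : f 1 = 1 := by
    have : f 1 = g (S.mkQ 1) := rfl
    rw [this, hg1, hone]; simp
  refine ⟨PositiveLinearMap.mk₀ f.toLinearMap fun a ha =>
    ContinuousLinearMap.apply_nonneg_of_norm_le_one hf hf1 ha, hf1, fun a => ?_⟩
  have hz : S.mkQ (α a) = S.mkQ a := by
    refine ((Submodule.Quotient.eq S).mpr ?_).symm
    exact ⟨a, hD a⟩
  exact congrArg g hz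

end InvariantStates

/-! ### A covariant representation from the GNS construction. -/

section GNS

open scoped ComplexOrder InnerProductSpace
open UniformSpace Completion

variable {A : Type u} [CStarAlgebra A] [PartialOrder A] [StarOrderedRing A]

/-- The isometry of the pre-GNS space of an invariant functional induced by an automorphism. -/
def PositiveLinearMap.preGNSMap (f : A →ₚ[ℂ] ℂ) (α : A ≃⋆ₐ[ℂ] A) (h : ∀ a, f (α a) = f a) :
    f.PreGNS →L[ℂ] f.PreGNS :=
  (f.toPreGNS.toLinearMap ∘ₗ (α : A →⋆ₐ[ℂ] A).toAlgHom.toLinearMap ∘ₗ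
    f.ofPreGNS.toLinearMap).mkContinuous 1 fun x => by
      rw [one_mul, f.preGNS_norm_def, f.preGNS_norm_def]
      refine Real.sqrt_le_sqrt (le_of_eq ?_)
      rw [← h (star (f.ofPreGNS x) * f.ofPreGNS x), map_mul α, map_star α]
      rfl

theorem PositiveLinearMap.preGNSMap_apply (f : A →ₚ[ℂ] ℂ) (α : A ≃⋆ₐ[ℂ] A)
    (h : ∀ a, f (α a) = f a) (x : f.PreGNS) :
    f.preGNSMap α h x = f.toPreGNS (α (f.ofPreGNS x)) := rfl

/-- Invariance of the state makes `α` and its inverse isometric on the pre-GNS space; their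
extensions to the completion are mutually inverse and adjoint, so they give the implementing
unitary. -/
theorem nonempty_covariantRep [Nontrivial A] (α : A ≃⋆ₐ[ℂ] A) : Nonempty (CovariantRep α) := by
  obtain ⟨f, hf1, hf⟩ := exists_invariant_state α
  have hf' : ∀ a, f (α.symm a) = f a := fun a => by rw [← hf, α.apply_symm_apply]
  let T : f.GNS →L[ℂ] f.GNS := (f.preGNSMap α hf).completion
  let T' : f.GNS →L[ℂ] f.GNS := (f.preGNSMap α.symm hf').completion
  have hT : ∀ x : f.PreGNS, T x = (f.toPreGNS (α (f.ofPreGNS x)) : f.PreGNS) := fun x => by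
    simp [T, PositiveLinearMap.preGNSMap_apply]
  have hT' : ∀ x : f.PreGNS, T' x = (f.toPreGNS (α.symm (f.ofPreGNS x)) : f.PreGNS) := fun x => by
    simp [T', PositiveLinearMap.preGNSMap_apply]
  have hstar : star T = T' := by
    refine ((ContinuousLinearMap.eq_adjoint_iff T' T).mpr fun x y => ?_).symm
    induction x, y using induction_on₂ with
    | hp => apply isClosed_eq <;> fun_prop
    | ih x y =>
      rw [hT, hT', inner_coe, inner_coe, f.preGNS_inner_def, f.preGNS_inner_def, ← hf]
      simp only [PositiveLinearMap.ofPreGNS_toPreGNS, map_mul α, map_star α, α.apply_symm_apply]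
  have h1 : T' * T = 1 := by
    ext x
    induction x using induction_on with
    | hp => apply isClosed_eq <;> fun_prop
    | ih x => simp [hT, hT']
  have h2 : T * T' = 1 := by
    ext x
    induction x using induction_on with
    | hp => apply isClosed_eq <;> fun_prop
    | ih x => simp [hT, hT']
  have hnt : Nontrivial f.GNS := by
    refine ⟨⟨((f.toPreGNS 1 : f.PreGNS) : f.GNS), 0, fun h0 => ?_⟩⟩
    have h3 : ‖((f.toPreGNS 1 : f.PreGNS) : f.GNS)‖ = 0 := by rw [h0, norm_zero]
    rw [norm_coe] at h3
    have h4 := f.preGNS_norm_sq (f.toPreGNS 1)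
    rw [h3] at h4
    simp [hf1] at h4
  exact ⟨{
    H := f.GNS
    π := f.gnsStarAlgHom
    U := ⟨T, by rw [Unitary.mem_iff, hstar]; exact ⟨h1, h2⟩⟩
    covariant := fun a => by
      change f.gnsStarAlgHom (α a) = T * f.gnsStarAlgHom a * star T
      rw [hstar]
      ext x
      induction x using induction_on with
      | hp => apply isClosed_eq <;> fun_prop
      | ih x => simp [hT, hT'] }⟩

end GNS

/-! ### Norm estimates for almost-shifted orthogonal towers. -/

section Tower

variable {A B : Type*} [CStarAlgebra A] [CStarAlgebra B] {α : A ≃⋆ₐ[ℂ] A}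

theorem norm_automorphism_apply (β : A ≃⋆ₐ[ℂ] A) (a : A) : ‖β a‖ = ‖a‖ :=
  NonUnitalStarAlgHom.norm_map β β.injective a

theorem norm_pow_apply_sub_le {c : ℕ → A} {n : ℕ} {ε : ℝ}
    (hα : ∀ i < n, ‖α (c i) - c (i + 1)‖ ≤ ε) (k j : ℕ) (hjk : j + k ≤ n) :
    ‖(α ^ k) (c j) - c (j + k)‖ ≤ k * ε := by
  induction k with
  | zero => simp
  | succ k ih =>
    have h1 := ih (by omega)
    have h2 : (α ^ (k + 1)) (c j) - c (j + (k + 1)) =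
        α ((α ^ k) (c j) - c (j + k)) + (α (c (j + k)) - c (j + k + 1)) := by
      rw [map_sub, pow_succ', sub_add_sub_cancel, ← add_assoc]
      rfl
    rw [h2]
    refine (norm_add_le _ _).trans ?_
    rw [norm_automorphism_apply]
    have h3 := hα (j + k) (by omega)
    push_cast
    linarith

/-- A tower longer than `2|k|` leaves room for `|k|` steps upwards or downwards from any level `j`.
Either `αᵏ(cⱼ)` is close to `cⱼ₊ₖ`, or `cⱼ` is close to `αᵏ(cⱼ₋ₖ)`; orthogonality of distinct levels
finishes both cases. Negative `k` reduces to positive by applying a power of `α` and taking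
adjoints. -/
theorem norm_mul_zpow_apply_le {c : ℕ → A} {n : ℕ} {ε : ℝ} (hs : ∀ i, star (c i) = c i)
    (hc : ∀ i, ‖c i‖ ≤ 1) (ho : ∀ i j, i ≠ j → c i * c j = 0)
    (hα : ∀ i < n, ‖α (c i) - c (i + 1)‖ ≤ ε) {j : ℕ} (hj : j ≤ n) {k : ℤ} (hk : k ≠ 0)
    (hkn : 2 * |k| ≤ n) : ‖c j * (α ^ k) (c j)‖ ≤ |k| * ε := by
  have key : ∀ l : ℕ, l ≠ 0 → 2 * l ≤ n → ‖c j * (α ^ l) (c j)‖ ≤ l * ε := by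
    intro l hl hln
    rcases le_total (j + l) n with h | h
    · have h1 := norm_pow_apply_sub_le hα l j h
      have h2 : c j * (α ^ l) (c j) = c j * ((α ^ l) (c j) - c (j + l)) := by
        rw [mul_sub, ho j (j + l) (by omega), sub_zero]
      rw [h2]
      refine (norm_mul_le _ _).trans (le_trans ?_ h1)
      exact mul_le_of_le_one_left (norm_nonneg _) (hc j)
    · have h1 := norm_pow_apply_sub_le hα l (j - l) (by omega)
      rw [Nat.sub_add_cancel (by omega)] at h1
      have h2 : c j * (α ^ l) (c j) = (c j - (α ^ l) (c (j - l))) * (α ^ l) (c j) := by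
        rw [sub_mul, ← map_mul, ho (j - l) j (by omega), map_zero, sub_zero]
      rw [h2]
      refine (norm_mul_le _ _).trans (le_trans ?_ h1)
      rw [norm_sub_rev, norm_automorphism_apply]
      exact mul_le_of_le_one_right (norm_nonneg _) (hc j)
  obtain ⟨l, rfl | rfl⟩ := Int.eq_nat_or_neg k
  · rw [zpow_natCast, Nat.abs_cast]
    exact key l (by simpa using hk) (by simpa [← Nat.cast_ofNat (R := ℤ)] using mod_cast hkn)
  · rw [abs_neg, Nat.abs_cast] at hkn ⊢
    refine le_trans (le_of_eq ?_) (key l (by simpa using hk) (by exact_mod_cast hkn))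
    have h1 : c j * (α ^ (-(l : ℤ))) (c j) = (α ^ (-(l : ℤ))) ((α ^ l) (c j) * c j) := by
      rw [map_mul, ← zpow_natCast, ← StarAlgEquiv.mul_apply, ← zpow_add]
      simp
    rw [h1, norm_automorphism_apply, ← norm_star, star_mul, ← map_star, hs]

variable {φ : A →⋆ₐ[ℂ] B} {u : unitary B}

/-- Moving `uᵏ` to the right turns each off-diagonal term into `cⱼ fₖ αᵏ(cⱼ) uᵏ`. Commuting `cⱼ`
past `fₖ` costs `ε`, and what remains contains the small product `cⱼ αᵏ(cⱼ)`. -/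
theorem norm_compress_laurentSum_sub_le (hu : ∀ a, φ (α a) = u * φ a * star (u : B))
    {c : ℕ → A} {n K : ℕ} {ε : ℝ} (hε : 0 ≤ ε) (hs : ∀ i, star (c i) = c i)
    (hc : ∀ i, ‖c i‖ ≤ 1) (ho : ∀ i j, i ≠ j → c i * c j = 0)
    (hα : ∀ i < n, ‖α (c i) - c (i + 1)‖ ≤ ε) {f : ℤ →₀ A} (hK : ∀ k ∈ f.support, |k| < K)
    (hn : 2 * K ≤ n) (hf : ∀ i, ∀ k ∈ f.support, ‖c i * f k - f k * c i‖ ≤ ε)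
    {j : ℕ} (hj : j ≤ n) :
    ‖φ (c j) * laurentSum φ u f * φ (c j) - φ (c j * f 0 * c j)‖ ≤
      (∑ k ∈ f.support, (1 + ‖f k‖ * K)) * ε := by
  have h1 : laurentSum φ u f = φ (f 0) + laurentSum φ u (f.erase 0) := by
    conv_lhs => rw [← Finsupp.single_add_erase 0 f]
    rw [laurentSum_add, laurentSum_single]
    simp
  have h2 : φ (c j) * laurentSum φ u f * φ (c j) - φ (c j * f 0 * c j) =
      ∑ k ∈ f.support.erase 0,
        φ (c j * f k * (α ^ k) (c j)) * ((u ^ k : unitary B) : B) := by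
    rw [h1, mul_add, add_mul, map_mul, map_mul, add_sub_cancel_left, laurentSum, Finsupp.sum,
      Finset.mul_sum, Finset.sum_mul, Finsupp.support_erase]
    refine Finset.sum_congr rfl fun k hk => ?_
    rw [Finsupp.erase_ne (Finset.ne_of_mem_erase hk), ← mul_assoc, mul_assoc,
      unitary_zpow_mul_of_covariant hu, ← mul_assoc, map_mul, map_mul]
  have hnn : ∀ k, 0 ≤ (1 + ‖f k‖ * K) * ε := fun k => by positivity
  rw [h2, Finset.sum_mul]
  refine le_trans ?_ (Finset.sum_le_sum_of_subset_of_nonneg (Finset.erase_subset 0 f.support)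
    fun k _ _ => hnn k)
  refine norm_sum_le_of_le _ fun k hk => ?_
  have hk0 := Finset.ne_of_mem_erase hk
  have hks := Finset.mem_of_mem_erase hk
  have hkK := hK k hks
  have h3 := norm_mul_zpow_apply_le hs hc ho hα hj hk0 (by omega)
  have hkK' : ((|k| : ℤ) : ℝ) ≤ K := by exact_mod_cast hkK.le
  have h4 : c j * f k * (α ^ k) (c j) =
      (c j * f k - f k * c j) * (α ^ k) (c j) + f k * (c j * (α ^ k) (c j)) := by
    noncomm_ring
  have hu1 : ‖((u ^ k : unitary B) : B)‖ ≤ 1 := by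
    rcases subsingleton_or_nontrivial B with hB | hB
    · simp [Subsingleton.elim ((u ^ k : unitary B) : B) 0]
    · exact (CStarRing.norm_coe_unitary _).le
  calc _ ≤ ‖φ (c j * f k * (α ^ k) (c j))‖ * ‖((u ^ k : unitary B) : B)‖ := norm_mul_le _ _
    _ ≤ ‖c j * f k * (α ^ k) (c j)‖ * 1 := by
        gcongr
        exact NonUnitalStarAlgHom.norm_apply_le φ _
    _ ≤ ‖c j * f k - f k * c j‖ * ‖(α ^ k) (c j)‖ + ‖f k‖ * ‖c j * (α ^ k) (c j)‖ := by
        rw [mul_one, h4]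
        exact (norm_add_le _ _).trans (add_le_add (norm_mul_le _ _) (norm_mul_le _ _))
    _ ≤ ε * 1 + ‖f k‖ * (K * ε) := by
        have := hf j k hks
        have h5 : ‖(α ^ k) (c j)‖ ≤ 1 := by rw [norm_automorphism_apply]; exact hc j
        have h6 : ‖c j * (α ^ k) (c j)‖ ≤ K * ε :=
          h3.trans (mul_le_mul_of_nonneg_right (by exact_mod_cast hkK') hε)
        gcongr
    _ = _ := by ring

/-- By orthogonality, each cross term `cᵢ a cⱼ` equals a commutator `[cᵢ, a]` times `cⱼ`. -/
theorem norm_sum_mul_mul_sum_sub_le {c : ℕ → A} {n : ℕ} {ε : ℝ} {a : A}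
    (hc : ∀ i, ‖c i‖ ≤ 1) (ho : ∀ i j, i ≠ j → c i * c j = 0)
    (ha : ∀ i, ‖c i * a - a * c i‖ ≤ ε) :
    ‖(∑ i ∈ Finset.range n, c i) * a * (∑ i ∈ Finset.range n, c i) -
      ∑ i ∈ Finset.range n, c i * a * c i‖ ≤ n * (n * ε) := by
  have hε : 0 ≤ ε := (norm_nonneg _).trans (ha 0)
  rw [Finset.sum_mul, Finset.sum_mul, ← Finset.sum_sub_distrib]
  refine (norm_sum_le_of_le (n := fun _ => n * ε) _ fun i hi => ?_).trans_eq (by simp)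
  rw [Finset.mul_sum, ← Finset.add_sum_erase _ _ hi, add_sub_cancel_left]
  refine (norm_sum_le_of_le (n := fun _ => ε) _ fun j hj => ?_).trans ?_
  · have h1 : c i * a * c j = (c i * a - a * c i) * c j := by
      rw [sub_mul, mul_assoc a, ho i j (Finset.ne_of_mem_erase hj).symm, mul_zero, sub_zero]
    rw [h1]
    refine (norm_mul_le _ _).trans (le_trans ?_ (ha i))
    exact mul_le_of_le_one_right (norm_nonneg _) (hc j)
  · rw [Finset.sum_const, nsmul_eq_mul]
    gcongr
    exact (Finset.card_erase_le).trans_eq (Finset.card_range n)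

end Tower

/-! ### Rokhlin towers indexed by the natural numbers. -/

section Rokhlin

/-- The towers provided by the tracial quasi-Rokhlin property, as sequences. -/
theorem HasTracialQuasiRokhlinProperty.exists_tower {A : Type u} [CStarAlgebra A] [PartialOrder A]
    [StarOrderedRing A] {α : A ≃⋆ₐ[ℂ] A} (h : HasTracialQuasiRokhlinProperty α) {ε : ℝ}
    (hε : 0 < ε) (F : Finset A) (n : ℕ) {x : A} (hx : 0 ≤ x) (hx1 : ‖x‖ = 1) :
    ∃ c : ℕ → A, (∀ i, 0 ≤ c i) ∧ (∀ i, c i ≤ 1) ∧ (∀ i j, i ≠ j → c i * c j = 0) ∧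
      (∀ i < n, ‖α (c i) - c (i + 1)‖ ≤ ε) ∧ (∀ i, ∀ a ∈ F, ‖c i * a - a * c i‖ ≤ ε) ∧
      1 - ε < ‖(∑ i ∈ Finset.range (n + 1), c i) * x * ∑ i ∈ Finset.range (n + 1), c i‖ := by
  obtain ⟨c, h1, h2, h3, h4, -, h6⟩ := h ε hε F n x hx hx1
  -- Extension by zero preserves positivity, orthogonality and the commutator bounds at every index;
  -- only the shift estimate needs `i < n`.
  refine ⟨fun i => if hi : i < n + 1 then c ⟨i, hi⟩ else 0, fun i => ?_, fun i => ?_,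
    fun i j hij => ?_, fun i hi => ?_, fun i a ha => ?_, ?_⟩
  · dsimp only
    split_ifs with hi
    exacts [(h1 _).1, le_rfl]
  · dsimp only
    split_ifs with hi
    exacts [(h1 _).2, zero_le_one]
  · dsimp only
    split_ifs with hi hj
    · exact h2 _ _ (by simpa using hij)
    all_goals simp
  · dsimp only
    rw [dif_pos (by omega), dif_pos (by omega)]
    exact (h3 ⟨i, hi⟩).le
  · dsimp only
    split_ifs with hi
    · exact (h4 _ a ha).le
    · simpa using hε.le
  · rw [Finset.sum_range]
    simpa only [Fin.is_lt, dite_true, Fin.eta] using h6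

end Rokhlin

/-! ### The simplicity argument. -/

section Simplicity

variable {A : Type u} [CStarAlgebra A] {α : A ≃⋆ₐ[ℂ] A} {B V : Type*} [CStarAlgebra B]
  [CStarAlgebra V] {φ : A →⋆ₐ[ℂ] B} {u : unitary B}

/-- The preimage of `J` in `A` is a closed ideal, and conjugation by `u` and by its adjoint shows
that it is `α`-invariant. -/
theorem IsAlphaSimple.map_mem_imp_or (hA : IsAlphaSimple α)
    (hu : ∀ a, φ (α a) = u * φ a * star (u : B)) {J : TwoSidedIdeal B}
    (hJ : IsClosed (J : Set B)) : (∀ a, φ a ∈ J → a = 0) ∨ (1 : B) ∈ J := by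
  have hmem : ∀ a, a ∈ J.comap φ ↔ φ a ∈ J := fun a => TwoSidedIdeal.mem_comap φ
  have hcl : IsClosed ((J.comap φ : TwoSidedIdeal A) : Set A) := by
    have h1 : ((J.comap φ : TwoSidedIdeal A) : Set A) = φ ⁻¹' J := Set.ext hmem
    rw [h1]
    exact hJ.preimage (AddMonoidHomClass.continuous_of_bound φ 1 fun a => by
      simpa using NonUnitalStarAlgHom.norm_apply_le φ a)
  have hinv : α '' ((J.comap φ : TwoSidedIdeal A) : Set A) = (J.comap φ : TwoSidedIdeal A) := by
    ext x
    constructor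
    · rintro ⟨a, ha, rfl⟩
      rw [SetLike.mem_coe, hmem] at ha ⊢
      rw [hu]
      exact J.mul_mem_right _ _ (J.mul_mem_left _ _ ha)
    · intro hx
      refine ⟨α⁻¹ x, ?_, α.apply_symm_apply x⟩
      rw [SetLike.mem_coe, hmem] at hx ⊢
      have h1 : φ (α⁻¹ x) = star (u : B) * φ x * u := by
        rw [unitary_star_mul_of_covariant hu, mul_assoc, Unitary.coe_star_mul_self, mul_one]
      rw [h1]
      exact J.mul_mem_right _ _ (J.mul_mem_left _ _ hx)
  rcases hA.2 _ hcl hinv with h | h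
  · left
    intro a ha
    rw [← hmem, h] at ha
    simpa using ha
  · right
    have : (1 : A) ∈ J.comap φ := h ▸ TwoSidedIdeal.mem_top _
    rwa [hmem, map_one] at this

variable [PartialOrder A] [StarOrderedRing A] {γ : Circle → B →⋆ₐ[ℂ] V}

/-- A C⋆-algebra generated by a covariant pair and carrying a gauge action is simple as soon as the
automorphism is minimal and has the tracial quasi-Rokhlin property. -/
theorem isSimpleCStarAlgebra_of_isGaugeFamily [Nontrivial B]
    (hα : HasTracialQuasiRokhlinProperty α) (hA : IsAlphaSimple α)
    (hu : ∀ a, φ (α a) = u * φ a * star (u : B))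
    (hd : Dense (StarAlgebra.adjoin ℂ (Set.range φ ∪ {(u : B)}) : Set B))
    (hγ : IsGaugeFamily φ u γ) : IsSimpleCStarAlgebra B := by
  let _ : PartialOrder B := CStarAlgebra.spectralOrder B
  have _ : StarOrderedRing B := CStarAlgebra.spectralOrderedRing B
  -- This is the dichotomy applied to the zero ideal, which does not contain `1`.
  have hφ : Function.Injective φ := by
    have hbot : IsClosed ((⊥ : TwoSidedIdeal B) : Set B) := by
      rw [TwoSidedIdeal.coe_bot]
      exact isClosed_singleton
    refine (injective_iff_map_eq_zero φ).mpr ?_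
    refine ((hA.map_mem_imp_or hu hbot).resolve_right fun h => ?_)
    exact one_ne_zero ((TwoSidedIdeal.mem_bot B).mp h)
  refine ⟨inferInstance, fun J hJ => or_iff_not_imp_left.mpr fun hJ0 => ?_⟩
  have hone : ∀ h : (1 : B) ∈ J, J = ⊤ := fun h => by
    rw [eq_top_iff]
    intro x _
    simpa using J.mul_mem_left x 1 h
  refine hone ((hA.map_mem_imp_or hu hJ).resolve_left fun hJA => ?_)
  obtain ⟨y, hyJ, hy⟩ : ∃ y ∈ J, y ≠ 0 := by
    by_contra! hcon
    exact hJ0 (eq_bot_iff.mpr fun x hx => (TwoSidedIdeal.mem_bot B).mpr (hcon x hx))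
  have hd' : ∀ b : B, ∀ ε > 0, ∃ f, ‖b - laurentSum φ u f‖ < ε := fun b ε hε =>
    exists_norm_sub_laurentSum_lt hu hd b hε
  obtain ⟨κ, hκ, hκy⟩ := hγ.exists_le_norm_coeff_zero hd' hy
  have hcont : Continuous fun p : B => star p * p := by fun_prop
  obtain ⟨δ, hδ, hδy⟩ := Metric.continuous_iff.mp hcont y (κ / 4) (by positivity)
  -- Approximating `y`, rather than `star y * y`, yields a Laurent sum of the form `star p * p`, so
  -- that its constant coefficient is positive.
  obtain ⟨f, hf⟩ := hd' y δ hδ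
  obtain ⟨f', hf'⟩ := exists_laurentSum_eq_star hu f
  obtain ⟨g, hg⟩ := exists_laurentSum_eq_mul hu f' f
  rw [← hf'] at hg
  have hyg : ‖star y * y - laurentSum φ u g‖ < κ / 4 := by
    have := hδy (laurentSum φ u f) (by rwa [dist_comm, dist_eq_norm])
    rwa [dist_comm, dist_eq_norm, hg] at this
  have hg0 : 0 ≤ g 0 := hγ.coeff_zero_nonneg hφ hg.symm
  have hgn : 3 / 4 * κ ≤ ‖g 0‖ := by linarith [hκy g]
  have hgpos : 0 < ‖g 0‖ := by linarith
  obtain ⟨K, -, hK⟩ := IsGaugeFamily.exists_forall_mem_support_abs_lt g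
  set n := 2 * K with hn
  set C := ∑ k ∈ g.support, (1 + ‖g k‖ * K) with hC
  have hC0 : 0 ≤ C := Finset.sum_nonneg fun k _ => by positivity
  set D : ℝ := (n + 1) * C + (n + 1) * (n + 1) with hD
  have hD0 : 0 < D := by positivity
  -- The bound `1 / 4` gives `‖s g₀ s‖ > (3/4)(3/4)κ = 9κ/16`. The other bound limits the tower
  -- errors to `κ / 8`; with the approximation error below `κ / 4` the total is below `3κ/8`.
  set ε : ℝ := min (1 / 4) (κ / 8 / D) with hε_def
  have hε : 0 < ε := by positivity
  have hε1 : ε ≤ 1 / 4 := min_le_left _ _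
  have hε2 : D * ε ≤ κ / 8 := by
    rw [mul_comm, ← le_div_iff₀ hD0]
    exact min_le_right _ _
  classical
  obtain ⟨c, hc0, hc1, ho, hcα, hcF, hcx⟩ := hα.exists_tower hε (insert (g 0) (g.support.image g)) n
    (x := ‖g 0‖⁻¹ • g 0) (smul_nonneg (by positivity) hg0)
    (by rw [norm_smul, norm_inv, norm_norm, inv_mul_cancel₀ hgpos.ne'])
  have hs : ∀ i, star (c i) = c i := fun i => IsSelfAdjoint.of_nonneg (hc0 i)
  have hcn : ∀ i, ‖c i‖ ≤ 1 := fun i => (CStarAlgebra.norm_le_one_iff_of_nonneg _ (hc0 i)).mpr (hc1 i)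
  set s := ∑ i ∈ Finset.range (n + 1), c i with hs_def
  have hss : star s = s := by simp only [hs_def, star_sum, hs]
  have hsg0 : 0 ≤ s * g 0 * s := by
    have := star_left_conjugate_nonneg hg0 s
    rwa [hss] at this
  have hsg : 9 / 16 * κ < ‖s * g 0 * s‖ := by
    rw [mul_smul_comm, smul_mul_assoc, norm_smul, norm_inv, norm_norm, lt_inv_mul_iff₀ hgpos] at hcx
    nlinarith
  set q : B := ∑ i ∈ Finset.range (n + 1), φ (c i) * (star y * y) * φ (c i) with hq
  have hqJ : q ∈ J := by
    refine sum_mem fun i _ => ?_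
    exact J.mul_mem_right _ _ (J.mul_mem_left _ _ (J.mul_mem_left _ _ hyJ))
  have hφs : ∀ i, star (φ (c i)) = φ (c i) := fun i => by rw [← map_star, hs]
  have hqs : IsSelfAdjoint q := by
    rw [IsSelfAdjoint, hq, star_sum]
    refine Finset.sum_congr rfl fun i _ => ?_
    rw [star_mul, star_mul, star_mul, star_star, hφs, mul_assoc (φ (c i))]
  have e1 : ‖∑ i ∈ Finset.range (n + 1),
      φ (c i) * (star y * y - laurentSum φ u g) * φ (c i)‖ ≤ ‖star y * y - laurentSum φ u g‖ := by
    refine norm_sum_conjugate_le _ (fun i => map_nonneg φ (hc0 i)) ?_ ?_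
    · refine sum_mul_self_le_one_of_orthogonal _ (fun i => map_nonneg φ (hc0 i)) (fun i => ?_)
        fun i j hij => ?_
      · rw [← map_one φ]
        exact OrderHomClass.mono φ (hc1 i)
      · rw [← map_mul, ho i j hij, map_zero]
    · rw [← hg]
      exact (IsSelfAdjoint.star_mul_self y).sub (IsSelfAdjoint.star_mul_self _)
  have e2 : ‖∑ i ∈ Finset.range (n + 1),
      (φ (c i) * laurentSum φ u g * φ (c i) - φ (c i * g 0 * c i))‖ ≤ (n + 1) * (C * ε) := by
    refine (norm_sum_le_of_le (n := fun _ => C * ε) _ fun i hi => ?_).trans_eq (by simp)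
    exact norm_compress_laurentSum_sub_le hu hε.le hs hcn ho hcα hK le_rfl
      (fun j k hk => hcF j _ (Finset.mem_insert_of_mem (Finset.mem_image_of_mem g hk)))
      (by simpa [Nat.lt_succ_iff] using hi)
  have e3 : ‖φ (s * g 0 * s - ∑ i ∈ Finset.range (n + 1), c i * g 0 * c i)‖ ≤
      (n + 1) * ((n + 1) * ε) := by
    refine (NonUnitalStarAlgHom.norm_apply_le φ _).trans ?_
    have := norm_sum_mul_mul_sum_sub_le (n := n + 1) hcn ho
      (fun i => hcF i (g 0) (Finset.mem_insert_self _ _))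
    exact_mod_cast this
  have e4 : φ (s * g 0 * s) - q =
      φ (s * g 0 * s - ∑ i ∈ Finset.range (n + 1), c i * g 0 * c i) -
      ∑ i ∈ Finset.range (n + 1),
        (φ (c i) * laurentSum φ u g * φ (c i) - φ (c i * g 0 * c i)) -
      ∑ i ∈ Finset.range (n + 1), φ (c i) * (star y * y - laurentSum φ u g) * φ (c i) := by
    simp only [mul_sub, sub_mul, Finset.sum_sub_distrib, map_sub, map_sum, hq]
    abel
  have e5 : ‖φ (s * g 0 * s) - q‖ < ‖s * g 0 * s‖ := by
    rw [e4]
    refine ((norm_sub_le _ _).trans (add_le_add ((norm_sub_le _ _).trans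
      (add_le_add e3 e2)) e1)).trans_lt ?_
    have : D * ε = (n + 1) * ((n + 1) * ε) + (n + 1) * (C * ε) := by rw [hD]; ring
    linarith
  obtain ⟨r, hr0, hr⟩ := TwoSidedIdeal.exists_ne_zero_map_mem φ hJ hsg0 hqJ hqs e5
  exact hr0 (hJA r hr)

end Simplicity

/-! ### Passage to the generated C⋆-subalgebra. -/

section GeneratedSubalgebra

variable {A : Type u} [CStarAlgebra A] [PartialOrder A] [StarOrderedRing A] {α : A ≃⋆ₐ[ℂ] A}
  {V : Type*} [CStarAlgebra V]

/-- The C⋆-subalgebra generated by a covariant pair carrying a gauge action is simple. -/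
theorem isSimpleCStarAlgebra_topologicalClosure_adjoin [Nontrivial V]
    (hα : HasTracialQuasiRokhlinProperty α) (hA : IsAlphaSimple α) {φ : A →⋆ₐ[ℂ] V}
    {u : unitary V} (hu : ∀ a, φ (α a) = u * φ a * star (u : V)) {γ : Circle → V →⋆ₐ[ℂ] V}
    (hγ : IsGaugeFamily φ u γ) {S : StarSubalgebra ℂ V} [IsClosed (S : Set V)]
    (hS : S = (StarAlgebra.adjoin ℂ (Set.range φ ∪ {(u : V)})).topologicalClosure) :
    IsSimpleCStarAlgebra S := by
  have hle : StarAlgebra.adjoin ℂ (Set.range φ ∪ {(u : V)}) ≤ S :=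
    hS ▸ StarSubalgebra.le_topologicalClosure _
  have hφS : ∀ a, φ a ∈ S := fun a =>
    hle (StarAlgebra.subset_adjoin ℂ _ (Or.inl ⟨a, rfl⟩))
  have huS : (u : V) ∈ S := hle (StarAlgebra.subset_adjoin ℂ _ (Or.inr rfl))
  let φS : A →⋆ₐ[ℂ] S := φ.codRestrict S hφS
  let uS : unitary S := ⟨⟨u, huS⟩, Subtype.ext (Unitary.star_mul_self_of_mem u.2),
    Subtype.ext (Unitary.mul_star_self_of_mem u.2)⟩
  have hmap : (StarAlgebra.adjoin ℂ (Set.range φS ∪ {(uS : S)})).map S.subtype =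
      StarAlgebra.adjoin ℂ (Set.range φ ∪ {(u : V)}) := by
    rw [StarAlgHom.map_adjoin, Set.image_union, Set.image_singleton, ← Set.range_comp]
    rfl
  refine isSimpleCStarAlgebra_of_isGaugeFamily (φ := φS) (u := uS)
    (γ := fun z => (γ z).comp S.subtype) hα hA (fun a => Subtype.ext (hu a)) ?_
    ⟨fun z a => hγ.map_coeff z a, fun z => hγ.map_unitary z,
      hγ.injective.comp Subtype.val_injective⟩
  intro x
  have hx : (x : V) ∈ closure (StarAlgebra.adjoin ℂ (Set.range φ ∪ {(u : V)}) : Set V) :=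
    hS.le x.2
  refine Metric.mem_closure_iff.mpr fun ε hε => ?_
  obtain ⟨p, hp, hxp⟩ := Metric.mem_closure_iff.mp hx ε hε
  rw [← hmap] at hp
  obtain ⟨p', hp', rfl⟩ := hp
  exact ⟨p', hp', hxp⟩

end GeneratedSubalgebra

/-! ### The gauge action on the universal representation, by reindexing along `(π, U) ↦ (π, zU)`. -/

section UniversalGauge

variable {A : Type u} [CStarAlgebra A] (α : A ≃⋆ₐ[ℂ] A)

/-- The universal covariant representation as a ⋆-homomorphism. -/
def universalHom : A →⋆ₐ[ℂ] UniversalOp α where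
  toFun := universalCoeff α
  map_one' := by ext ρ : 2; exact map_one ρ.π
  map_mul' a b := by ext ρ : 2; exact map_mul ρ.π a b
  map_zero' := by ext ρ : 2; exact map_zero ρ.π
  map_add' a b := by ext ρ : 2; exact map_add ρ.π a b
  commutes' r := by ext ρ : 2; exact AlgHomClass.commutes ρ.π r
  map_star' a := by ext ρ : 2; exact map_star ρ.π a

theorem universalUnitary_mem : universalUnitary α ∈ unitary (UniversalOp α) := by
  constructor
  · ext ρ : 2; exact Unitary.star_mul_self_of_mem ρ.U.2
  · ext ρ : 2; exact Unitary.mul_star_self_of_mem ρ.U.2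

variable {α}

theorem universalHom_apply_automorphism (a : A) :
    universalHom α (α a) =
      universalUnitary α * universalHom α a * star (universalUnitary α) := by
  ext ρ : 2; exact ρ.covariant a

theorem Circle.star_coe_mul_self (z : Circle) : star (z : ℂ) * z = 1 := by
  have : star (z : ℂ) = (z : ℂ)⁻¹ := by
    rw [← Circle.coe_inv, Circle.coe_inv_eq_conj]
    rfl
  rw [this, inv_mul_cancel₀ (Circle.coe_ne_zero z)]

/-- The covariant representation `(π, zU)`. -/
def CovariantRep.twist (z : Circle) (ρ : CovariantRep α) : CovariantRep α where
  H := ρ.H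
  π := ρ.π
  U := ⟨(z : ℂ) • (ρ.U : ρ.Op), by
    rw [Unitary.mem_iff, star_smul, smul_mul_smul_comm, smul_mul_smul_comm,
      Unitary.star_mul_self_of_mem ρ.U.2, Unitary.mul_star_self_of_mem ρ.U.2, mul_comm (z : ℂ),
      Circle.star_coe_mul_self]
    simp⟩
  covariant a := by
    change ρ.π (α a) = ((z : ℂ) • (ρ.U : ρ.Op)) * ρ.π a * star ((z : ℂ) • (ρ.U : ρ.Op))
    rw [star_smul, smul_mul_assoc, smul_mul_smul_comm, mul_comm (z : ℂ),
      Circle.star_coe_mul_self, one_smul, ρ.covariant]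

/-- This equality of representations is what makes the gauge map at `1` injective: every coordinate
of a family is recovered after reindexing. -/
theorem CovariantRep.twist_one (ρ : CovariantRep α) : ρ.twist 1 = ρ := by
  have h : (⟨((1 : Circle) : ℂ) • (ρ.U : ρ.Op), (ρ.twist 1).U.2⟩ : unitary ρ.Op) = ρ.U :=
    Subtype.ext (by simp)
  cases ρ
  simp only [CovariantRep.twist] at h ⊢
  congr

variable (α) in
/-- The gauge action of the circle on the universal covariant representation. -/
def universalGauge (z : Circle) : UniversalOp α →⋆ₐ[ℂ] UniversalOp α where
  toFun f := ⟨fun ρ => (f (ρ.twist z) : ρ.Op), memℓp_infty ⟨‖f‖, by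
    rintro _ ⟨ρ, rfl⟩
    exact lp.norm_apply_le_norm ENNReal.top_ne_zero f (ρ.twist z)⟩⟩
  map_one' := rfl
  map_mul' f g := rfl
  map_zero' := rfl
  map_add' f g := rfl
  commutes' r := rfl
  map_star' f := rfl

theorem isGaugeFamily_universalGauge :
    IsGaugeFamily (universalHom α) ⟨universalUnitary α, universalUnitary_mem α⟩
      (universalGauge α) where
  map_coeff z a := rfl
  map_unitary z := by
    ext ρ : 2
    change (z : ℂ) • (ρ.U : ρ.Op) = (z : ℂ) • (((1 : Circle) : ℂ) • (ρ.U : ρ.Op))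
    simp
  injective := by
    intro f g hfg
    ext ρ : 2
    have h : f (ρ.twist 1) = g (ρ.twist 1) :=
      congrFun (congrArg Subtype.val hfg) ρ
    rw [ρ.twist_one] at h
    exact h

theorem nontrivial_universalOp (h : Nonempty (CovariantRep α)) : Nontrivial (UniversalOp α) := by
  obtain ⟨ρ⟩ := h
  refine ⟨⟨1, 0, fun h0 => ?_⟩⟩
  exact one_ne_zero (α := ρ.Op) (congrFun (congrArg Subtype.val h0) ρ)

end UniversalGauge

theorem mainTheorem1 {A : Type u} [CStarAlgebra A] [PartialOrder A] [StarOrderedRing A]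
    [TopologicalSpace.SeparableSpace A] (α : A ≃⋆ₐ[ℂ] A)
    (hα : HasTracialQuasiRokhlinProperty α) (hA : IsAlphaSimple α) :
    IsSimpleCStarAlgebra (crossedProduct α) := by
  have : Nontrivial A := hA.1
  have : Nontrivial (UniversalOp α) := nontrivial_universalOp (nonempty_covariantRep α)
  exact isSimpleCStarAlgebra_topologicalClosure_adjoin hα hA
    (u := ⟨universalUnitary α, universalUnitary_mem α⟩) universalHom_apply_automorphism
    isGaugeFamily_universalGauge rfl

end
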